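/- Let $n,q\ge 0$ be integers and let $\mathcal D=\mathbb C[D_1,\dots,D_n]$ be the ring of constant-coefficient differential operators on $\mathbb R^n$, where $D_j=\frac1{\imath}\frac{\partial}{\partial x_j}$, acting on $\mathcal C^\infty(\mathbb R^n)$ (complex-valued smooth functions). Let $\mathcal C^\infty(\mathbb{PT})\subset\mathcal C^\infty(\mathbb R^n)$ be the space of smooth functions that are periodic with respect to the lattice $2\pi N\mathbb Z^n$ for some integer $N\ge1$ depending on the function, let $\mathcal C^\infty(\mathbb{PT})_{\mathrm{fin}}$ be the subspace of those whose Fourier series $\sum_{a\in\mathbb Q^n}c_ae^{\imath\langle a,x\rangle}$ is a finite sum, and let $\mathcal F=\mathcal C^\infty(\mathbb{PT})_{\mathrm{fin}}[x_1,\dots,x_n]\subset\mathcal C^\infty(\mathbb R^n)$ be the subalgebra obtained by adjoining the coordinate functions; it is a $\mathcal D$-submodule of $\mathcal C^\infty(\mathbb R^n)$. For a submodule $\mathcal M\subset\mathcal D^q$ put $\mathcal M^\perp=\{f\in\mathcal F^q : \sum_j r_j(f_j)=0 \text{ for all } r\in\mathcal M\}$, and let $\mathcal M^{\perp\perp}=\{r\in\mathcal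 D^q : \sum_j r_j(f_j)=0\text{ for all } f\in\mathcal M^\perp\}$ be the Willems closure of $\mathcal M$ with respect to $\mathcal F$. Then: 1. $\mathcal M^{\perp\perp}$ consists of the elements $x\in\mathcal D^q$ for which the ideal $\{r\in\mathcal D : rx\in\mathcal M\}$ is not contained in any maximal ideal of the form $(D_1-b_1,\dots,D_n-b_n)$ with $(b_1,\dots,b_n)\in\mathbb Q^n$. 2. $\mathcal M^{\perp\perp}$ is the largest submodule $\mathcal M^+$ of $\mathcal D^q$ containing $\mathcal M$ such that the support $S\subset\mathbb A^n=\mathbb C^n$ of $\mathcal M^+/\mathcal M$ satisfies $S\cap\mathbb Q^n=\emptyset$. -/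

import Mathlib

open scoped ContDiff

noncomputable section

namespace PeriodicBehavior

/-! ### Behaviors and the Willems closure over an arbitrary signal module -/

section Willems

variable {R : Type*} [CommRing R] {q : ℕ}

/-- The behavior `M^⊥ ⊆ F^q` of a submodule `M ⊆ R^q`: all `(f_1, …, f_q)` with
`∑ r_j (f_j) = 0` for every `(r_1, …, r_q) ∈ M`. -/
def behavior (F : Type*) [AddCommGroup F] [Module R F] (M : Submodule R (Fin q → R)) :
    Submodule R (Fin q → F) where
  carrier := {f | ∀ r ∈ M, ∑ j, r j • f j = 0}
  zero_mem' := by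
    intro r _
    simp
  add_mem' := by
    intro f g hf hg r hr
    simp [smul_add, Finset.sum_add_distrib, hf r hr, hg r hr]
  smul_mem' := by
    intro c f hf r hr
    have h := congrArg (fun y => c • y) (hf r hr)
    simpa [Finset.smul_sum, smul_comm c] using h

/-- The orthogonal `B^⊥ ⊆ R^q` of `B ⊆ F^q`: all `(r_1, …, r_q)` with
`∑ r_j (f_j) = 0` for every `(f_1, …, f_q) ∈ B`. -/
def equations {F : Type*} [AddCommGroup F] [Module R F] (B : Submodule R (Fin q → F)) :
    Submodule R (Fin q → R) where
  carrier := {r | ∀ f ∈ B, ∑ j, r j • f j = 0}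
  zero_mem' := by
    intro f _
    simp
  add_mem' := by
    intro r s hr hs f hf
    simp [add_smul, Finset.sum_add_distrib, hr f hf, hs f hf]
  smul_mem' := by
    intro c r hr f hf
    have h := congrArg (fun y => c • y) (hr f hf)
    simpa [Finset.smul_sum, smul_smul] using h

/-- The Willems closure `M^⊥⊥ ⊆ R^q` of `M ⊆ R^q` with respect to the signal module `F`. -/
def willemsClosure (F : Type*) [AddCommGroup F] [Module R F] (M : Submodule R (Fin q → R)) :
    Submodule R (Fin q → R) :=
  equations (behavior F M)

end Willems

/-! ### Smooth functions on `ℝⁿ` as a module over the ring of differential operators -/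

/-- The ring `ℂ[D_1, …, D_n]` of differential operators with constant coefficients; the variable
`X j` stands for `D_j = (1/i) ∂_j`, see `instModuleDiffOp` and `X_smul`. -/
abbrev DiffOp (n : ℕ) : Type := MvPolynomial (Fin n) ℂ

/-- The algebra `C^∞(ℝⁿ)` of smooth complex-valued functions on `ℝⁿ`. -/
def smooth (n : ℕ) : Subalgebra ℂ ((Fin n → ℝ) → ℂ) where
  carrier := {f | ContDiff ℝ ∞ f}
  mul_mem' := by
    intro f g hf hg
    exact ContDiff.mul (show ContDiff ℝ ∞ f from hf) (show ContDiff ℝ ∞ g from hg)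
  add_mem' := by
    intro f g hf hg
    exact ContDiff.add (show ContDiff ℝ ∞ f from hf) (show ContDiff ℝ ∞ g from hg)
  algebraMap_mem' := by
    intro c
    exact show ContDiff ℝ ∞ (fun _ : Fin n → ℝ => c) from contDiff_const

theorem contDiff_smooth {n : ℕ} (f : smooth n) : ContDiff ℝ ∞ (f : (Fin n → ℝ) → ℂ) := f.2

/-- The operator `D_j = (1/i) ∂/∂x_j` on `C^∞(ℝⁿ)`. -/
def partialD {n : ℕ} (j : Fin n) : smooth n →ₗ[ℂ] smooth n where
  toFun f := ⟨fun x => (1 / Complex.I) * fderiv ℝ (f : (Fin n → ℝ) → ℂ) x (Pi.single j 1),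
    show ContDiff ℝ ∞ _ from contDiff_const.mul
      (((contDiff_smooth f).fderiv_right (m := ∞) (by simp)).clm_apply contDiff_const)⟩
  map_add' := by
    intro f g
    ext x
    have hf : DifferentiableAt ℝ (f : (Fin n → ℝ) → ℂ) x :=
      (contDiff_smooth f).differentiable (by simp) x
    have hg : DifferentiableAt ℝ (g : (Fin n → ℝ) → ℂ) x :=
      (contDiff_smooth g).differentiable (by simp) x
    change (1 / Complex.I) * fderiv ℝ ((f : (Fin n → ℝ) → ℂ) + (g : (Fin n → ℝ) → ℂ)) x
      (Pi.single j 1) = (1 / Complex.I) * fderiv ℝ (f : (Fin n → ℝ) → ℂ) x (Pi.single j 1) +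
        (1 / Complex.I) * fderiv ℝ (g : (Fin n → ℝ) → ℂ) x (Pi.single j 1)
    rw [fderiv_add hf hg, add_apply, mul_add]
  map_smul' := by
    intro c f
    ext x
    have hf : DifferentiableAt ℝ (f : (Fin n → ℝ) → ℂ) x :=
      (contDiff_smooth f).differentiable (by simp) x
    change (1 / Complex.I) * fderiv ℝ (c • (f : (Fin n → ℝ) → ℂ)) x (Pi.single j 1) =
      c * ((1 / Complex.I) * fderiv ℝ (f : (Fin n → ℝ) → ℂ) x (Pi.single j 1))
    rw [fderiv_const_smul hf c, smul_apply, smul_eq_mul]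
    ring

theorem partialD_apply {n : ℕ} (j : Fin n) (f : smooth n) (x : Fin n → ℝ) :
    (partialD j f : (Fin n → ℝ) → ℂ) x =
      (1 / Complex.I) * fderiv ℝ (f : (Fin n → ℝ) → ℂ) x (Pi.single j 1) := rfl

theorem partialD_comm {n : ℕ} (j k : Fin n) : partialD j * partialD k = partialD k * partialD j := by
  have key : ∀ (a b : Fin n) (f : smooth n) (x : Fin n → ℝ),
      (partialD a (partialD b f) : (Fin n → ℝ) → ℂ) x = (1 / Complex.I) * ((1 / Complex.I) *
        fderiv ℝ (fderiv ℝ (f : (Fin n → ℝ) → ℂ)) x (Pi.single a 1) (Pi.single b 1)) := by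
    intro a b f x
    have h1 : DifferentiableAt ℝ (fderiv ℝ (f : (Fin n → ℝ) → ℂ)) x :=
      ((contDiff_smooth f).fderiv_right (m := ∞) (by simp)).differentiable (by simp) x
    have h2 : HasFDerivAt (partialD b f : (Fin n → ℝ) → ℂ) _ x :=
      (h1.hasFDerivAt.clm_apply (hasFDerivAt_const (Pi.single b (1 : ℝ)) x)).const_mul
        (1 / Complex.I)
    rw [partialD_apply, h2.fderiv]
    simp
  refine LinearMap.ext fun f => Subtype.ext (funext fun x => ?_)
  have hs : IsSymmSndFDerivAt ℝ (f : (Fin n → ℝ) → ℂ) x :=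
    (contDiff_smooth f).contDiffAt.isSymmSndFDerivAt (by
      simp only [minSmoothness_of_isRCLikeNormedField]
      exact WithTop.coe_le_coe.2 le_top)
  change (partialD j (partialD k f) : (Fin n → ℝ) → ℂ) x =
    (partialD k (partialD j f) : (Fin n → ℝ) → ℂ) x
  rw [key, key, hs.eq]

/-- The algebra of operators on `C^∞(ℝⁿ)` generated by `D_1, …, D_n`. -/
abbrev operators (n : ℕ) : Subalgebra ℂ (Module.End ℂ (smooth n)) :=
  Algebra.adjoin ℂ (Set.range (partialD (n := n)))

instance instIsMulCommutativeOperators (n : ℕ) : IsMulCommutative (operators n) :=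
  Algebra.isMulCommutative_adjoin ℂ (by
    rintro _ ⟨j, rfl⟩ _ ⟨k, rfl⟩
    exact partialD_comm j k)

open scoped IsMulCommutative in
/-- The action of `ℂ[D_1, …, D_n]` on `C^∞(ℝⁿ)` with `X j` acting as `D_j`. -/
def action (n : ℕ) : DiffOp n →ₐ[ℂ] Module.End ℂ (smooth n) :=
  (operators n).val.comp
    (MvPolynomial.aeval fun j => (⟨partialD j, Algebra.subset_adjoin ⟨j, rfl⟩⟩ : operators n))

instance instModuleDiffOp (n : ℕ) : Module (DiffOp n) (smooth n) :=
  Module.compHom (smooth n) (action n).toRingHom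

theorem smul_def {n : ℕ} (r : DiffOp n) (f : smooth n) : r • f = action n r f := rfl

open scoped IsMulCommutative in
theorem X_smul {n : ℕ} (j : Fin n) (f : smooth n) :
    (MvPolynomial.X j : DiffOp n) • f = partialD j f := by
  simp [smul_def, action]

theorem C_smul {n : ℕ} (c : ℂ) (f : smooth n) :
    (MvPolynomial.C c : DiffOp n) • f = c • f := by
  rw [smul_def, ← MvPolynomial.algebraMap_eq, AlgHom.commutes]
  rfl

/-! ### Periodic functions and the signal space -/

/-- `C^∞` of the protorus: smooth functions on `ℝⁿ` that are periodic with respect to the lattice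
`2πNℤⁿ` for some integer `N ≥ 1` depending on the function. -/
def protorusSmooth (n : ℕ) : Set (smooth n) :=
  {f | ∃ N : ℕ, 1 ≤ N ∧ ∀ (k : Fin n → ℤ) (x : Fin n → ℝ),
    (f : (Fin n → ℝ) → ℂ) (fun j => x j + 2 * Real.pi * N * k j) = (f : (Fin n → ℝ) → ℂ) x}

/-- The elements of `C^∞` of the protorus whose Fourier series `∑ c_a e^{i⟨a,x⟩}`, `a ∈ ℚⁿ`, is a
finite sum. -/
def protorusFin (n : ℕ) : Set (smooth n) :=
  {f | f ∈ protorusSmooth n ∧ ∃ c : (Fin n → ℚ) →₀ ℂ, ∀ x : Fin n → ℝ,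
    (f : (Fin n → ℝ) → ℂ) x =
      c.sum fun a z => z * Complex.exp (Complex.I * ∑ j, (a j : ℂ) * (x j : ℂ))}

/-- The coordinate function `x_j` on `ℝⁿ`. -/
def coord {n : ℕ} (j : Fin n) : smooth n :=
  ⟨fun x => (x j : ℂ), show ContDiff ℝ ∞ _ from Complex.ofRealCLM.contDiff.comp (contDiff_apply ℝ ℝ j)⟩

/-- The subalgebra of `C^∞(ℝⁿ)` obtained by adjoining the coordinate functions `x_1, …, x_n` to
the finite Fourier sums on the protorus. -/
def signalAlgebra (n : ℕ) : Subalgebra ℂ (smooth n) :=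
  Algebra.adjoin ℂ (protorusFin n ∪ Set.range (coord (n := n)))

theorem partialD_mul {n : ℕ} (j : Fin n) (f g : smooth n) :
    partialD j (f * g) = f * partialD j g + partialD j f * g := by
  refine Subtype.ext (funext fun x => ?_)
  have hf : DifferentiableAt ℝ (f : (Fin n → ℝ) → ℂ) x :=
    (contDiff_smooth f).differentiable (by simp) x
  have hg : DifferentiableAt ℝ (g : (Fin n → ℝ) → ℂ) x :=
    (contDiff_smooth g).differentiable (by simp) x
  have h := (hf.hasFDerivAt.mul hg.hasFDerivAt).fderiv
  change (partialD j (f * g) : (Fin n → ℝ) → ℂ) x =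
    (f : (Fin n → ℝ) → ℂ) x * (partialD j g : (Fin n → ℝ) → ℂ) x +
      (partialD j f : (Fin n → ℝ) → ℂ) x * (g : (Fin n → ℝ) → ℂ) x
  rw [partialD_apply, partialD_apply, partialD_apply]
  change (1 / Complex.I) * (fderiv ℝ ((f : (Fin n → ℝ) → ℂ) * (g : (Fin n → ℝ) → ℂ)) x)
    (Pi.single j 1) = _
  rw [h]
  simp
  ring

theorem partialD_const {n : ℕ} (j : Fin n) (c : ℂ) :
    partialD j (algebraMap ℂ (smooth n) c) = 0 := by
  refine Subtype.ext (funext fun x => ?_)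
  rw [partialD_apply]
  change (1 / Complex.I) * (fderiv ℝ (fun _ : Fin n → ℝ => c) x) (Pi.single j 1) = 0
  simp

theorem partialD_coord {n : ℕ} (j k : Fin n) :
    partialD j (coord k) = algebraMap ℂ (smooth n) (if k = j then 1 / Complex.I else 0) := by
  refine Subtype.ext (funext fun x => ?_)
  have h : HasFDerivAt (coord k : (Fin n → ℝ) → ℂ)
      (Complex.ofRealCLM.comp (ContinuousLinearMap.proj k)) x :=
    (Complex.ofRealCLM.comp (ContinuousLinearMap.proj (R := ℝ) (φ := fun _ : Fin n => ℝ) k)).hasFDerivAt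
  rw [partialD_apply, h.fderiv]
  change _ = (if k = j then 1 / Complex.I else 0 : ℂ)
  by_cases hkj : k = j
  · subst hkj
    simp
  · simp [hkj]

theorem partialD_mem_protorusFin {n : ℕ} (j : Fin n) {f : smooth n} (hf : f ∈ protorusFin n) :
    partialD j f ∈ protorusFin n := by
  obtain ⟨⟨N, hN, hper⟩, c, hc⟩ := hf
  refine ⟨⟨N, hN, fun k x => ?_⟩,
    Finsupp.onFinset c.support (fun a => (a j : ℂ) * c a) (by intro a; simp), fun x => ?_⟩
  · rw [partialD_apply, partialD_apply]
    have h : (fun y : Fin n → ℝ => (f : (Fin n → ℝ) → ℂ)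
        (y + fun j => 2 * Real.pi * N * k j)) = (f : (Fin n → ℝ) → ℂ) :=
      funext fun y => hper k y
    have h2 := fderiv_comp_add_right (𝕜 := ℝ) (f := (f : (Fin n → ℝ) → ℂ)) (x := x)
      (fun j : Fin n => 2 * Real.pi * N * k j)
    rw [h] at h2
    rw [h2]
    rfl
  · have hco : ∀ i : Fin n, HasFDerivAt (fun y : Fin n → ℝ => (y i : ℂ))
        (Complex.ofRealCLM.comp
          (ContinuousLinearMap.proj (R := ℝ) (φ := fun _ : Fin n => ℝ) i)) x := fun i =>
      (Complex.ofRealCLM.comp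
        (ContinuousLinearMap.proj (R := ℝ) (φ := fun _ : Fin n => ℝ) i)).hasFDerivAt
    have hlin : ∀ a : Fin n → ℚ, HasFDerivAt
        (fun y : Fin n → ℝ => ∑ i, (a i : ℂ) * (y i : ℂ))
        (∑ i, (a i : ℂ) • Complex.ofRealCLM.comp
          (ContinuousLinearMap.proj (R := ℝ) (φ := fun _ : Fin n => ℝ) i)) x := fun a =>
      HasFDerivAt.fun_sum fun i _ => (hco i).const_mul (a i : ℂ)
    have hf : HasFDerivAt (f : (Fin n → ℝ) → ℂ) (∑ a ∈ c.support, c a •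
        (Complex.exp (Complex.I * ∑ i, (a i : ℂ) * (x i : ℂ)) • (Complex.I •
          ∑ i, (a i : ℂ) • Complex.ofRealCLM.comp
            (ContinuousLinearMap.proj (R := ℝ) (φ := fun _ : Fin n => ℝ) i)))) x := by
      rw [show (f : (Fin n → ℝ) → ℂ) = fun y => ∑ a ∈ c.support,
        c a * Complex.exp (Complex.I * ∑ i, (a i : ℂ) * (y i : ℂ)) from funext hc]
      exact HasFDerivAt.fun_sum fun a _ => (((hlin a).const_mul Complex.I).cexp).const_mul (c a)
    rw [partialD_apply, hf.fderiv, Finsupp.onFinset_sum _ (by intro a; simp)]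
    rw [sum_apply, Finset.mul_sum]
    refine Finset.sum_congr rfl fun a _ => ?_
    have hsum : (∑ i, (a i : ℂ) • Complex.ofRealCLM.comp
        (ContinuousLinearMap.proj (R := ℝ) (φ := fun _ : Fin n => ℝ) i)) (Pi.single j 1) =
          (a j : ℂ) := by
      rw [sum_apply, Finset.sum_eq_single j]
      · simp
      · intro i _ hi
        simp [hi]
      · simp
    rw [smul_apply, smul_apply, smul_apply, hsum]
    simp only [smul_eq_mul, one_div]
    field_simp

theorem partialD_mem_signalAlgebra {n : ℕ} (j : Fin n) {f : smooth n}
    (hf : f ∈ signalAlgebra n) : partialD j f ∈ signalAlgebra n := by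
  induction hf using Algebra.adjoin_induction with
  | mem f hf =>
    rcases hf with hf | ⟨k, rfl⟩
    · exact Algebra.subset_adjoin (Or.inl (partialD_mem_protorusFin j hf))
    · rw [partialD_coord]
      exact Subalgebra.algebraMap_mem _ _
  | algebraMap c =>
    rw [partialD_const]
    exact Subalgebra.zero_mem _
  | add f g _ _ hf hg =>
    rw [map_add]
    exact Subalgebra.add_mem _ hf hg
  | mul f g hf' hg' hf hg =>
    rw [partialD_mul]
    exact Subalgebra.add_mem _ (Subalgebra.mul_mem _ hf' hg) (Subalgebra.mul_mem _ hf hg')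

/-- The signal space `C^∞(protorus)_fin[x_1, …, x_n]`, as a `ℂ[D_1, …, D_n]`-submodule of
`C^∞(ℝⁿ)`. -/
def signalSpace (n : ℕ) : Submodule (DiffOp n) (smooth n) where
  carrier := {f | f ∈ signalAlgebra n}
  zero_mem' := show 0 ∈ signalAlgebra n from Subalgebra.zero_mem _
  add_mem' := by
    intro f g hf hg
    exact show f + g ∈ signalAlgebra n from Subalgebra.add_mem _ hf hg
  smul_mem' := by
    intro r f hf
    change f ∈ signalAlgebra n at hf
    change r • f ∈ signalAlgebra n
    induction r using MvPolynomial.induction_on generalizing f with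
    | C c =>
      rw [C_smul]
      exact Subalgebra.smul_mem _ hf c
    | add p r hp hr =>
      rw [add_smul]
      exact Subalgebra.add_mem _ (hp hf) (hr hf)
    | mul_X p j hp =>
      rw [mul_smul, X_smul]
      exact hp (partialD_mem_signalAlgebra j hf)

/-! ### Points of affine space and supports -/

/-- The ideal `(D_1 - b_1, …, D_n - b_n)`. -/
def pointIdeal {n : ℕ} (b : Fin n → ℂ) : Ideal (DiffOp n) :=
  Ideal.span (Set.range fun j => MvPolynomial.X j - MvPolynomial.C (b j))

theorem pointIdeal_eq_ker {n : ℕ} (b : Fin n → ℂ) :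
    pointIdeal b = RingHom.ker (MvPolynomial.eval b) := by
  apply le_antisymm
  · refine Ideal.span_le.2 ?_
    rintro _ ⟨j, rfl⟩
    simp [RingHom.mem_ker]
  · have key : ∀ p : DiffOp n, p - MvPolynomial.C (MvPolynomial.eval b p) ∈ pointIdeal b := by
      intro p
      induction p using MvPolynomial.induction_on with
      | C c => simp
      | add p r hp hr =>
        have h := Ideal.add_mem _ hp hr
        convert h using 1
        simp
        ring
      | mul_X p j hp =>
        have h := Ideal.add_mem _ (Ideal.mul_mem_right (MvPolynomial.X j) _ hp)
          (Ideal.mul_mem_left (pointIdeal b) (MvPolynomial.C (MvPolynomial.eval b p))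
            (Ideal.subset_span ⟨j, rfl⟩))
        convert h using 1
        simp
        ring
    intro p hp
    have h := key p
    rw [RingHom.mem_ker] at hp
    simpa [hp] using h

instance pointIdeal_isMaximal {n : ℕ} (b : Fin n → ℂ) : (pointIdeal b).IsMaximal := by
  rw [pointIdeal_eq_ker]
  exact RingHom.ker_isMaximal_of_surjective _ fun c => ⟨MvPolynomial.C c, by simp⟩

/-- The closed point of `Spec ℂ[D_1, …, D_n]` given by `b ∈ 𝔸ⁿ = ℂⁿ`. -/
def point {n : ℕ} (b : Fin n → ℂ) : PrimeSpectrum (DiffOp n) :=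
  ⟨pointIdeal b, (pointIdeal_isMaximal b).isPrime⟩

/-- The support, as a subset of `𝔸ⁿ = ℂⁿ`, of a module over `ℂ[D_1, …, D_n]`. -/
def affineSupport {n : ℕ} (Q : Type*) [AddCommGroup Q] [Module (DiffOp n) Q] :
    Set (Fin n → ℂ) :=
  {b | point b ∈ Module.support (DiffOp n) Q}

/-- The rational points `ℚⁿ` of `𝔸ⁿ = ℂⁿ`. -/
def rationalPoints (n : ℕ) : Set (Fin n → ℂ) :=
  Set.range fun (b : Fin n → ℚ) (j : Fin n) => (b j : ℂ)

end PeriodicBehavior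

end

open scoped ContDiff
noncomputable section
namespace PeriodicBehavior

/-! Write `m_b` for the maximal ideal of a point `b` and `(M : x)` for the ideal of all `r` with `r
• x ∈ M`. Everything reduces to the first claim, which has two halves.

If `(M : x)` lies in no rational `m_b`, take `f ∈ M^⊥`. The signal `g = ∑ x_j f_j` is killed by `(M
: x)`. If `g ≠ 0`, its annihilator lies in some maximal ideal, which is an `m_b` with `b` rational
by `rationalTorsion_of_mem_signalAlgebra`; this is a contradiction.

If `(M : x) ⊆ m_b` with `b` rational, Krull's intersection theorem (`exists_functional`) gives a
`ℂ`-linear `ℓ` on `D^q` that kills `M` and some `m_b^k D^q` but not `x`. Formally, `ℓ (e^{i⟨t,D⟩}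
y)`, as a function of `t`, depends `D`-linearly on `y`. Since `ℓ` kills `m_b^k D^q`, it is
`e^{i⟨b,t⟩}` times a polynomial (`inverseSystem`), hence a signal. The images of the basis vectors
form an element of `M^⊥` on which `x` takes the value `ℓ x ≠ 0` at the origin.

The second claim follows because `b` lies in the support of `N/M` exactly when some `x ∈ N` has `(M
: x) ⊆ m_b` (`mem_affineSupport_iff`). -/

/-! ### Exponential functions with rational frequency -/

/-- The exponential function `x ↦ e^{i⟨b,x⟩}` with frequency `b ∈ ℚⁿ`. -/
def expo {n : ℕ} (b : Fin n → ℚ) : smooth n :=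
  ⟨fun x => Complex.exp (Complex.I * ∑ j, (b j : ℂ) * (x j : ℂ)),
    show ContDiff ℝ ∞ _ from (contDiff_const.mul (ContDiff.sum fun j _ =>
      contDiff_const.mul (contDiff_smooth (coord j)))).cexp⟩

theorem expo_apply {n : ℕ} (b : Fin n → ℚ) (x : Fin n → ℝ) :
    (expo b : (Fin n → ℝ) → ℂ) x = Complex.exp (Complex.I * ∑ j, (b j : ℂ) * (x j : ℂ)) := rfl

theorem expo_zero {n : ℕ} : expo (0 : Fin n → ℚ) = 1 := by
  refine Subtype.ext (funext fun x => ?_)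
  rw [expo_apply]
  simp

theorem expo_add {n : ℕ} (a b : Fin n → ℚ) : expo (a + b) = expo a * expo b := by
  refine Subtype.ext (funext fun x => ?_)
  change _ = (expo a : (Fin n → ℝ) → ℂ) x * (expo b : (Fin n → ℝ) → ℂ) x
  rw [expo_apply, expo_apply, expo_apply, ← Complex.exp_add, ← mul_add, ← Finset.sum_add_distrib]
  congr 2
  refine Finset.sum_congr rfl fun j _ => ?_
  simp [add_mul]

theorem partialD_expo {n : ℕ} (j : Fin n) (b : Fin n → ℚ) :
    partialD j (expo b) = (b j : ℂ) • expo b := by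
  refine Subtype.ext (funext fun x => ?_)
  have hco : ∀ i : Fin n, HasFDerivAt (fun y : Fin n → ℝ => (y i : ℂ))
      (Complex.ofRealCLM.comp
        (ContinuousLinearMap.proj (R := ℝ) (φ := fun _ : Fin n => ℝ) i)) x := fun i =>
    (Complex.ofRealCLM.comp
      (ContinuousLinearMap.proj (R := ℝ) (φ := fun _ : Fin n => ℝ) i)).hasFDerivAt
  have hlin : HasFDerivAt (fun y : Fin n → ℝ => ∑ i, (b i : ℂ) * (y i : ℂ))
      (∑ i, (b i : ℂ) • Complex.ofRealCLM.comp
        (ContinuousLinearMap.proj (R := ℝ) (φ := fun _ : Fin n => ℝ) i)) x :=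
    HasFDerivAt.fun_sum fun i _ => (hco i).const_mul (b i : ℂ)
  have h : HasFDerivAt (expo b : (Fin n → ℝ) → ℂ) _ x := (hlin.const_mul Complex.I).cexp
  have hsum : (∑ i, (b i : ℂ) • Complex.ofRealCLM.comp
      (ContinuousLinearMap.proj (R := ℝ) (φ := fun _ : Fin n => ℝ) i)) (Pi.single j 1) =
        (b j : ℂ) := by
    rw [sum_apply, Finset.sum_eq_single j]
    · simp
    · intro i _ hi
      simp [hi]
    · simp
  rw [partialD_apply, h.fderiv, smul_apply, smul_apply, hsum]
  change _ = (b j : ℂ) * (expo b : (Fin n → ℝ) → ℂ) x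
  rw [expo_apply]
  simp only [smul_eq_mul, one_div]
  field_simp

theorem expo_mem_protorusFin {n : ℕ} (b : Fin n → ℚ) : expo b ∈ protorusFin n := by
  -- The product of the denominators clears every `b j`, so a lattice translation changes the
  -- exponent by an integer multiple of `2πi`.
  refine ⟨⟨∏ j, (b j).den, Nat.one_le_iff_ne_zero.2
    (Finset.prod_ne_zero_iff.2 fun j _ => (b j).den_ne_zero), fun k x => ?_⟩,
    Finsupp.single b 1, fun x => by simp [expo_apply]⟩
  have hint : ∀ j, ∃ m : ℤ, (b j : ℂ) * ((∏ j, (b j).den : ℕ) : ℂ) = m := by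
    intro j
    obtain ⟨d, hd⟩ := Finset.dvd_prod_of_mem (fun j => (b j).den) (Finset.mem_univ j)
    refine ⟨(b j).num * d, ?_⟩
    rw [hd]
    have h : (b j : ℂ) * ((b j).den : ℂ) = (b j).num := by
      exact_mod_cast congrArg (fun t : ℚ => (t : ℂ)) (Rat.mul_den_eq_num (b j))
    push_cast
    rw [← mul_assoc, h]
  choose m hm using hint
  rw [expo_apply, expo_apply]
  have h : Complex.I * ∑ j, (b j : ℂ) *
      ((x j + 2 * Real.pi * (∏ j, (b j).den : ℕ) * k j : ℝ) : ℂ) =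
      Complex.I * (∑ j, (b j : ℂ) * (x j : ℂ)) +
        ((∑ j, m j * k j : ℤ) : ℂ) * (2 * Real.pi * Complex.I) := by
    rw [Int.cast_sum, Finset.sum_mul, Finset.mul_sum, Finset.mul_sum, ← Finset.sum_add_distrib]
    refine Finset.sum_congr rfl fun j _ => ?_
    rw [Int.cast_mul, ← hm j]
    push_cast
    ring
  rw [h]
  exact Complex.exp_periodic.int_mul _ _

theorem eq_sum_expo_of_mem_protorusFin {n : ℕ} {f : smooth n} (hf : f ∈ protorusFin n) :
    ∃ c : (Fin n → ℚ) →₀ ℂ, f = ∑ a ∈ c.support, c a • expo a := by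
  obtain ⟨_, c, hc⟩ := hf
  refine ⟨c, Subtype.ext (funext fun x => ?_)⟩
  rw [hc x, AddSubmonoidClass.coe_finsetSum, Finset.sum_apply]
  rfl

/-! ### Behaviors in a submodule of signals -/

theorem mem_behavior_submodule {R F : Type*} [CommRing R] [AddCommGroup F] [Module R F] {q : ℕ}
    (S : Submodule R F) (M : Submodule R (Fin q → R)) (f : Fin q → S) :
    f ∈ behavior S M ↔ ∀ r ∈ M, ∑ j, r j • (f j : F) = 0 := by
  refine forall₂_congr fun r _ => ?_
  rw [← Submodule.coe_eq_zero, AddSubmonoidClass.coe_finsetSum]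
  rfl

theorem mem_willemsClosure_submodule {R F : Type*} [CommRing R] [AddCommGroup F] [Module R F]
    {q : ℕ} (S : Submodule R F) (M : Submodule R (Fin q → R)) (x : Fin q → R) :
    x ∈ willemsClosure S M ↔ ∀ f ∈ behavior S M, ∑ j, x j • (f j : F) = 0 := by
  refine forall₂_congr fun f _ => ?_
  rw [← Submodule.coe_eq_zero, AddSubmonoidClass.coe_finsetSum]
  rfl

/-! ### The torsion of the signal space -/

theorem diffOp_smul_smul {n : ℕ} (r : DiffOp n) (c : ℂ) (f : smooth n) :
    r • (c • f) = c • (r • f) := by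
  rw [smul_def, smul_def, map_smul]

/-- The commutator with `x_j` is a derivation in `r`, and `[D_k, x_j]` is `1/i` for `k = j` and zero
otherwise; hence it is `1/i` times the formal derivative. -/
theorem smul_coord_mul {n : ℕ} (r : DiffOp n) (j : Fin n) (g : smooth n) :
    r • (coord j * g) =
      coord j * (r • g) + (1 / Complex.I) • (MvPolynomial.pderiv j r • g) := by
  induction r using MvPolynomial.induction_on generalizing g with
  | C c => simp [C_smul]
  | add p r hp hr =>
    simp only [add_smul, hp, hr, map_add, mul_add, smul_add]
    abel
  | mul_X p k hp =>
    have h : partialD k (coord j * g) =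
        coord j * partialD k g + (if j = k then (1 / Complex.I : ℂ) else 0) • g := by
      rw [partialD_mul, partialD_coord, Algebra.smul_def]
    rw [mul_smul, X_smul, h, smul_add, hp, diffOp_smul_smul, Derivation.leibniz,
      MvPolynomial.pderiv_X, mul_smul, X_smul, add_smul, smul_add, smul_eq_mul, smul_eq_mul,
      mul_comm (MvPolynomial.X k), mul_smul _ (MvPolynomial.X k), X_smul]
    rcases eq_or_ne j k with rfl | hjk
    · simp
      abel
    · simp [hjk]

/-- Every maximal ideal containing the annihilator of `g` is the ideal of a rational point. -/
def RationalTorsion {n : ℕ} (g : smooth n) : Prop :=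
  ∀ m : Ideal (DiffOp n), m.IsMaximal → (∀ r : DiffOp n, r • g = 0 → r ∈ m) →
    ∃ b ∈ rationalPoints n, m = pointIdeal b

/-- Ann(f)·Ann(g) annihilates `f + g`, so a prime containing Ann(f + g) contains Ann(f) or Ann(g).
-/
theorem RationalTorsion.add {n : ℕ} {f g : smooth n} (hf : RationalTorsion f)
    (hg : RationalTorsion g) : RationalTorsion (f + g) := by
  intro m hm h
  by_cases hf' : ∀ r : DiffOp n, r • f = 0 → r ∈ m
  · exact hf m hm hf'
  refine hg m hm fun s hs => ?_
  push Not at hf'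
  obtain ⟨r, hr, hrm⟩ := hf'
  refine (hm.isPrime.mem_or_mem (h (r * s) ?_)).resolve_left hrm
  rw [smul_add, mul_smul r s g, hs, mul_comm, mul_smul, hr]
  simp

theorem RationalTorsion.smul {n : ℕ} {f : smooth n} (hf : RationalTorsion f) (c : ℂ) :
    RationalTorsion (c • f) := fun m hm h => hf m hm fun r hr => h r (by
  rw [diffOp_smul_smul, hr, smul_zero])

theorem RationalTorsion.zero {n : ℕ} : RationalTorsion (0 : smooth n) := fun m hm h =>
  absurd ((Ideal.eq_top_iff_one m).2 (h 1 (smul_zero _))) hm.ne_top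

theorem RationalTorsion.sum {n : ℕ} {ι : Type*} (s : Finset ι) {f : ι → smooth n}
    (hf : ∀ i ∈ s, RationalTorsion (f i)) : RationalTorsion (∑ i ∈ s, f i) :=
  Finset.sum_induction f RationalTorsion (fun _ _ => RationalTorsion.add) RationalTorsion.zero hf

theorem RationalTorsion.coord_mul {n : ℕ} {f : smooth n} (hf : RationalTorsion f) (j : Fin n) :
    RationalTorsion (coord j * f) := by
  intro m hm h
  refine hf m hm fun r hr => ?_
  -- If `r` kills `f`, then `r²` kills `x_j f`: the derivative of `r²` is still a multiple of `r`.
  refine (hm.isPrime.mem_or_mem (h (r * r) ?_)).elim id id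
  rw [smul_coord_mul, Derivation.leibniz, smul_eq_mul, add_smul, mul_smul r r, hr,
    mul_comm r, mul_smul _ r f, hr]
  simp

theorem rationalTorsion_expo {n : ℕ} (b : Fin n → ℚ) : RationalTorsion (expo b) := by
  intro m hm h
  refine ⟨fun j => (b j : ℂ), ⟨b, rfl⟩, ?_⟩
  refine ((pointIdeal_isMaximal _).eq_of_le hm.ne_top (Ideal.span_le.2 ?_)).symm
  rintro _ ⟨j, rfl⟩
  refine h _ ?_
  rw [sub_smul, X_smul, C_smul, partialD_expo, sub_self]

theorem rationalTorsion_of_mem_signalAlgebra {n : ℕ} {u : smooth n} (hu : u ∈ signalAlgebra n) :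
    RationalTorsion u := by
  -- Closure of `RationalTorsion` under products is not available, so the induction tracks
  -- multiplication by `u` as an operator. The quantifier over all `b` absorbs the frequency shifts
  -- caused by Fourier terms of `u`.
  have key : ∀ g : smooth n, (∀ b, RationalTorsion (expo b * g)) →
      ∀ b, RationalTorsion (expo b * (u * g)) := by
    induction hu using Algebra.adjoin_induction with
    | mem f hf =>
      intro g hg b
      rcases hf with hf | ⟨k, rfl⟩
      · obtain ⟨c, rfl⟩ := eq_sum_expo_of_mem_protorusFin hf
        rw [Finset.sum_mul, Finset.mul_sum]
        refine RationalTorsion.sum _ fun a _ => ?_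
        rw [smul_mul_assoc, mul_smul_comm, ← mul_assoc, ← expo_add]
        exact (hg _).smul _
      · rw [mul_left_comm]
        exact (hg b).coord_mul k
    | algebraMap c =>
      intro g hg b
      rw [← Algebra.smul_def, mul_smul_comm]
      exact (hg b).smul c
    | add f f' _ _ hf hf' =>
      intro g hg b
      rw [add_mul, mul_add]
      exact (hf g hg b).add (hf' g hg b)
    | mul f f' _ _ hf hf' =>
      intro g hg b
      rw [mul_assoc]
      exact hf _ (hf' g hg) b
  have h := key 1 (fun b => by simpa using rationalTorsion_expo b) 0
  simpa [expo_zero] using h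

theorem mem_willemsClosure_of_forall {n q : ℕ} {M : Submodule (DiffOp n) (Fin q → DiffOp n)}
    {x : Fin q → DiffOp n} (hx : ∀ b ∈ rationalPoints n,
      ¬ {r : DiffOp n | r • x ∈ M} ⊆ (pointIdeal b : Set (DiffOp n))) :
    x ∈ willemsClosure (signalSpace n) M := by
  rw [mem_willemsClosure_submodule]
  intro f hf
  rw [mem_behavior_submodule] at hf
  by_contra hne
  have hann : ∀ r : DiffOp n, r • x ∈ M → r • ∑ j, x j • (f j : smooth n) = 0 := by
    intro r hr
    rw [Finset.smul_sum, ← hf _ hr]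
    exact Finset.sum_congr rfl fun j _ => (mul_smul r (x j) (f j : smooth n)).symm
  have hg : ∑ j, x j • (f j : smooth n) ∈ signalSpace n :=
    Submodule.sum_mem _ fun j _ => Submodule.smul_mem _ _ (f j).2
  have htop : (Submodule.span (DiffOp n) {∑ j, x j • (f j : smooth n)}).annihilator ≠ ⊤ := by
    intro h
    have h1 := (Ideal.eq_top_iff_one _).1 h
    rw [Submodule.mem_annihilator_span_singleton, one_smul] at h1
    exact hne h1
  obtain ⟨m, hm, hle⟩ := Ideal.exists_le_maximal _ htop
  have hmem : ∀ r : DiffOp n, r • ∑ j, x j • (f j : smooth n) = 0 → r ∈ m := fun r hr =>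
    hle ((Submodule.mem_annihilator_span_singleton _ _).2 hr)
  obtain ⟨b, hb, rfl⟩ := rationalTorsion_of_mem_signalAlgebra hg m hm hmem
  exact hx b hb fun r hr => hmem r (hann r hr)

/-! ### Macaulay duality at a rational point -/

/-- The functional `s ↦ ℓ (r s)`, as a linear function of `ℓ`. -/
def contract {n : ℕ} (r : DiffOp n) : (DiffOp n →ₗ[ℂ] ℂ) →ₗ[ℂ] (DiffOp n →ₗ[ℂ] ℂ) :=
  LinearMap.lcomp ℂ ℂ (LinearMap.mulLeft ℂ r)

theorem contract_apply {n : ℕ} (r : DiffOp n) (ℓ : DiffOp n →ₗ[ℂ] ℂ) (s : DiffOp n) :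
    contract r ℓ s = ℓ (r * s) := rfl

/-- The degree `m` part of the polynomial function `x ↦ ℓ (e^{i ∑ x_j (D_j - b_j)})`. -/
def expPart {n : ℕ} (b : Fin n → ℂ) : ℕ → (DiffOp n →ₗ[ℂ] ℂ) → smooth n
  | 0, ℓ => algebraMap ℂ (smooth n) (ℓ 1)
  | m + 1, ℓ => (1 / ((m : ℂ) + 1)) • ∑ j, (Complex.I • coord j) *
      expPart b m (contract (MvPolynomial.X j - MvPolynomial.C (b j)) ℓ)

theorem expPart_zero {n : ℕ} (b : Fin n → ℂ) (ℓ : DiffOp n →ₗ[ℂ] ℂ) :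
    expPart b 0 ℓ = algebraMap ℂ (smooth n) (ℓ 1) := rfl

theorem expPart_succ {n : ℕ} (b : Fin n → ℂ) (m : ℕ) (ℓ : DiffOp n →ₗ[ℂ] ℂ) :
    expPart b (m + 1) ℓ = (1 / ((m : ℂ) + 1)) • ∑ j, (Complex.I • coord j) *
      expPart b m (contract (MvPolynomial.X j - MvPolynomial.C (b j)) ℓ) := rfl

theorem expPart_add {n : ℕ} (b : Fin n → ℂ) (m : ℕ) (ℓ ℓ' : DiffOp n →ₗ[ℂ] ℂ) :
    expPart b m (ℓ + ℓ') = expPart b m ℓ + expPart b m ℓ' := by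
  induction m generalizing ℓ ℓ' with
  | zero => simp only [expPart_zero, LinearMap.add_apply, map_add]
  | succ m ih => simp only [expPart_succ, map_add, ih, mul_add, Finset.sum_add_distrib, smul_add]

theorem expPart_smul {n : ℕ} (b : Fin n → ℂ) (m : ℕ) (c : ℂ) (ℓ : DiffOp n →ₗ[ℂ] ℂ) :
    expPart b m (c • ℓ) = c • expPart b m ℓ := by
  induction m generalizing ℓ with
  | zero => rw [expPart_zero, expPart_zero, LinearMap.smul_apply, smul_eq_mul, map_mul,
      Algebra.smul_def]
  | succ m ih =>
    simp only [expPart_succ, map_smul, ih, mul_smul_comm, ← Finset.smul_sum]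
    rw [smul_comm]

theorem contract_comm {n : ℕ} (r s : DiffOp n) (ℓ : DiffOp n →ₗ[ℂ] ℂ) :
    contract r (contract s ℓ) = contract s (contract r ℓ) := by
  refine LinearMap.ext fun t => ?_
  simp only [contract_apply]
  rw [mul_left_comm]

/-- This is `∂_k e^{i⟨x,δ⟩} = i δ_k e^{i⟨x,δ⟩}` in a single degree, where `δ_j = D_j - b_j`. -/
theorem partialD_expPart_succ {n : ℕ} (b : Fin n → ℂ) (k : Fin n) (m : ℕ)
    (ℓ : DiffOp n →ₗ[ℂ] ℂ) : partialD k (expPart b (m + 1) ℓ) =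
      expPart b m (contract (MvPolynomial.X k - MvPolynomial.C (b k)) ℓ) := by
  have hcoord : ∀ j, partialD k (Complex.I • coord j) =
      algebraMap ℂ (smooth n) (if j = k then 1 else 0) := by
    intro j
    rw [map_smul, partialD_coord, Algebra.smul_def, ← map_mul]
    congr 1
    split_ifs <;> simp
  induction m generalizing ℓ with
  | zero =>
    rw [expPart_succ, map_smul, map_sum]
    simp only [partialD_mul, hcoord, expPart_zero, partialD_const, mul_zero, zero_add]
    simp [apply_ite]
  | succ m ih =>
    have hm : ((m : ℂ) + 1) ≠ 0 := Nat.cast_add_one_ne_zero m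
    have hm' : ((m : ℂ) + 1 + 1) ≠ 0 := by
      have h := Nat.cast_add_one_ne_zero (R := ℂ) (m + 1)
      rwa [Nat.cast_add_one] at h
    rw [expPart_succ, map_smul, map_sum]
    simp only [partialD_mul, hcoord, ih]
    rw [Finset.sum_add_distrib]
    -- In the product rule, differentiating the inner factors gives `m + 1` copies of the answer,
    -- and differentiating the outer coordinate (`h2`) gives one more; the prefactor `1/(m + 2)`
    -- cancels the total.
    have h1 : ∑ j, (Complex.I • coord j) * expPart b m
        (contract (MvPolynomial.X k - MvPolynomial.C (b k))
          (contract (MvPolynomial.X j - MvPolynomial.C (b j)) ℓ)) =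
        ((m : ℂ) + 1) • expPart b (m + 1)
          (contract (MvPolynomial.X k - MvPolynomial.C (b k)) ℓ) := by
      rw [expPart_succ, smul_smul, mul_one_div_cancel hm, one_smul]
      simp only [contract_comm (MvPolynomial.X k - MvPolynomial.C (b k))]
    have h2 : ∑ j, algebraMap ℂ (smooth n) (if j = k then 1 else 0) * expPart b (m + 1)
        (contract (MvPolynomial.X j - MvPolynomial.C (b j)) ℓ) =
        expPart b (m + 1) (contract (MvPolynomial.X k - MvPolynomial.C (b k)) ℓ) := by
      rw [Finset.sum_eq_single k]
      · simp
      · intro j _ hj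
        simp [hj]
      · simp
    rw [h1, h2]
    push_cast
    have h3 : ∀ g : smooth n, ((m : ℂ) + 1) • g + g = ((m : ℂ) + 1 + 1) • g := fun g => by
      rw [add_smul ((m : ℂ) + 1) 1, one_smul]
    rw [h3, smul_smul, one_div_mul_cancel hm', one_smul]

/-- Degree `m` evaluates `ℓ` only on products of `m` factors `D_j - b_j`. -/
theorem expPart_eq_zero {n : ℕ} (b : Fin n → ℂ) (m : ℕ) (ℓ : DiffOp n →ₗ[ℂ] ℂ)
    (hℓ : ∀ s ∈ pointIdeal b ^ m, ℓ s = 0) : expPart b m ℓ = 0 := by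
  induction m generalizing ℓ with
  | zero => rw [expPart_zero, hℓ 1 (by simp), map_zero]
  | succ m ih =>
    rw [expPart_succ, Finset.sum_eq_zero, smul_zero]
    intro j _
    rw [ih, mul_zero]
    intro s hs
    refine hℓ _ ?_
    rw [pow_succ']
    exact Ideal.mul_mem_mul (Ideal.subset_span ⟨j, rfl⟩) hs

theorem expPart_mem_signalAlgebra {n : ℕ} (b : Fin n → ℂ) (m : ℕ) (ℓ : DiffOp n →ₗ[ℂ] ℂ) :
    expPart b m ℓ ∈ signalAlgebra n := by
  induction m generalizing ℓ with
  | zero => exact Subalgebra.algebraMap_mem _ _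
  | succ m ih =>
    rw [expPart_succ]
    have hcoord : ∀ j : Fin n, coord j ∈ signalAlgebra n := fun j =>
      Algebra.subset_adjoin (Or.inr ⟨j, rfl⟩)
    exact Subalgebra.smul_mem _ (Subalgebra.sum_mem _ fun j _ => Subalgebra.mul_mem _
      (Subalgebra.smul_mem _ (hcoord j) _) (ih _)) _

theorem expPart_succ_apply_zero {n : ℕ} (b : Fin n → ℂ) (m : ℕ) (ℓ : DiffOp n →ₗ[ℂ] ℂ) :
    (expPart b (m + 1) ℓ : (Fin n → ℝ) → ℂ) 0 = 0 := by
  have hcoord : ∀ j : Fin n, (coord j : (Fin n → ℝ) → ℂ) 0 = 0 := fun j => by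
    change (((0 : Fin n → ℝ) j : ℝ) : ℂ) = 0
    simp
  rw [expPart_succ]
  simp [hcoord, Finset.sum_apply]

/-- The function `x ↦ e^{i⟨b,x⟩} ℓ (e^{i ∑ x_j (D_j - b_j)})`, with the inner exponential truncated
at degree `k`. -/
def inverseSystem {n : ℕ} (b : Fin n → ℚ) (k : ℕ) : (DiffOp n →ₗ[ℂ] ℂ) →ₗ[ℂ] smooth n where
  toFun ℓ := expo b * ∑ m ∈ Finset.range k, expPart (fun j => (b j : ℂ)) m ℓ
  map_add' ℓ ℓ' := by simp only [expPart_add, Finset.sum_add_distrib, mul_add]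
  map_smul' c ℓ := by
    simp only [expPart_smul, ← Finset.smul_sum, mul_smul_comm, RingHom.id_apply]

theorem inverseSystem_apply {n : ℕ} (b : Fin n → ℚ) (k : ℕ) (ℓ : DiffOp n →ₗ[ℂ] ℂ) :
    inverseSystem b k ℓ =
      expo b * ∑ m ∈ Finset.range k, expPart (fun j => (b j : ℂ)) m ℓ := rfl

theorem inverseSystem_mem_signalSpace {n : ℕ} (b : Fin n → ℚ) (k : ℕ) (ℓ : DiffOp n →ₗ[ℂ] ℂ) :
    inverseSystem b k ℓ ∈ signalSpace n := by
  change _ ∈ signalAlgebra n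
  rw [inverseSystem_apply]
  exact Subalgebra.mul_mem _ (Algebra.subset_adjoin (Or.inl (expo_mem_protorusFin b)))
    (Subalgebra.sum_mem _ fun m _ => expPart_mem_signalAlgebra _ m ℓ)

/-- Only the constant term survives at the origin; truncating at `k + 1` guarantees that it is
present. -/
theorem inverseSystem_succ_apply_zero {n : ℕ} (b : Fin n → ℚ) (k : ℕ) (ℓ : DiffOp n →ₗ[ℂ] ℂ) :
    (inverseSystem b (k + 1) ℓ : (Fin n → ℝ) → ℂ) 0 = ℓ 1 := by
  rw [inverseSystem_apply, Finset.sum_range_succ']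
  change (expo b : (Fin n → ℝ) → ℂ) 0 *
    ((∑ m ∈ Finset.range k, expPart (fun j => (b j : ℂ)) (m + 1) ℓ +
      expPart (fun j => (b j : ℂ)) 0 ℓ : smooth n) : (Fin n → ℝ) → ℂ) 0 = ℓ 1
  rw [expo_apply, expPart_zero]
  simp [expPart_succ_apply_zero, Finset.sum_apply]

/-- By Leibniz, the exponential contributes `b_j` and the polynomial part contributes `D_j - b_j`,
which add up to `D_j`. -/
theorem partialD_inverseSystem {n : ℕ} (b : Fin n → ℚ) (k : ℕ) (ℓ : DiffOp n →ₗ[ℂ] ℂ)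
    (hℓ : ∀ s ∈ pointIdeal (fun j => (b j : ℂ)) ^ (k + 1), ℓ s = 0) (j : Fin n) :
    partialD j (inverseSystem b (k + 1) ℓ) =
      inverseSystem b (k + 1) (contract (MvPolynomial.X j) ℓ) := by
  set δ : DiffOp n := MvPolynomial.X j - MvPolynomial.C (b j : ℂ) with hδ
  have hX : contract (MvPolynomial.X j) ℓ = contract δ ℓ + (b j : ℂ) • ℓ := by
    refine LinearMap.ext fun s => ?_
    rw [LinearMap.add_apply, LinearMap.smul_apply, contract_apply, contract_apply, ← map_smul,
      ← map_add, MvPolynomial.smul_eq_C_mul, hδ]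
    congr 1
    ring
  -- Differentiation lowers degrees, so it cannot produce the degree `k` part of the right-hand
  -- side. The vanishing of `ℓ` on `m_b^(k+1)` makes that part zero.
  have hlast : expPart (fun j => (b j : ℂ)) k (contract δ ℓ) = 0 := by
    refine expPart_eq_zero _ _ _ fun s hs => hℓ _ ?_
    rw [pow_succ']
    exact Ideal.mul_mem_mul (Ideal.subset_span ⟨j, rfl⟩) hs
  have hpart : partialD j (∑ m ∈ Finset.range (k + 1), expPart (fun j => (b j : ℂ)) m ℓ) =
      ∑ m ∈ Finset.range (k + 1), expPart (fun j => (b j : ℂ)) m (contract δ ℓ) := by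
    rw [Finset.sum_range_succ', map_add, map_sum, expPart_zero, partialD_const, add_zero,
      Finset.sum_range_succ, hlast, add_zero]
    exact Finset.sum_congr rfl fun m _ => partialD_expPart_succ _ j m ℓ
  rw [hX, map_add, map_smul, inverseSystem_apply, inverseSystem_apply, partialD_mul, hpart,
    partialD_expo, smul_mul_assoc]

theorem smul_inverseSystem {n : ℕ} (b : Fin n → ℚ) (k : ℕ) (r : DiffOp n)
    (ℓ : DiffOp n →ₗ[ℂ] ℂ)
    (hℓ : ∀ s ∈ pointIdeal (fun j => (b j : ℂ)) ^ (k + 1), ℓ s = 0) :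
    r • inverseSystem b (k + 1) ℓ = inverseSystem b (k + 1) (contract r ℓ) := by
  induction r using MvPolynomial.induction_on generalizing ℓ with
  | C c =>
    rw [C_smul, ← map_smul]
    congr 1
    refine LinearMap.ext fun s => ?_
    rw [contract_apply, ← MvPolynomial.smul_eq_C_mul, map_smul, LinearMap.smul_apply]
  | add p r hp hr =>
    rw [add_smul, hp ℓ hℓ, hr ℓ hℓ, ← map_add]
    congr 1
    refine LinearMap.ext fun s => ?_
    simp [contract_apply, add_mul]
  | mul_X p j hp =>
    rw [mul_smul, X_smul, partialD_inverseSystem b k ℓ hℓ,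
      hp (contract (MvPolynomial.X j) ℓ) fun s hs => hℓ _ (Ideal.mul_mem_left _ _ hs)]
    congr 1
    refine LinearMap.ext fun s => ?_
    simp only [contract_apply]
    congr 1
    ring

theorem exists_functional {n q : ℕ} {M : Submodule (DiffOp n) (Fin q → DiffOp n)}
    {x : Fin q → DiffOp n} {I : Ideal (DiffOp n)} (hI : I ≠ ⊤)
    (hx : {r : DiffOp n | r • x ∈ M} ⊆ (I : Set (DiffOp n))) :
    ∃ (k : ℕ) (ℓ : (Fin q → DiffOp n) →ₗ[ℂ] ℂ), (∀ y ∈ M, ℓ y = 0) ∧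
      (∀ s ∈ I ^ k, ∀ y, ℓ (s • y) = 0) ∧ ℓ x ≠ 0 := by
  -- Krull: a class in the intersection is fixed by some `r ∈ I`. Then `1 - r ∈ (M : x) ⊆ I`,
  -- forcing `1 ∈ I`.
  have hnot : M.mkQ x ∉ (⨅ i : ℕ, I ^ i • ⊤ :
      Submodule (DiffOp n) ((Fin q → DiffOp n) ⧸ M)) := by
    rw [Ideal.mem_iInf_smul_pow_eq_bot_iff]
    rintro ⟨r, hr⟩
    have h : (1 - (r : DiffOp n)) • x ∈ M := by
      rw [← Submodule.Quotient.mk_eq_zero, ← Submodule.mkQ_apply, map_smul, sub_smul, one_smul, hr,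
        sub_self]
    refine hI ((Ideal.eq_top_iff_one I).2 ?_)
    have h' := I.add_mem (hx h) r.2
    simpa using h'
  rw [Submodule.mem_iInf] at hnot
  push Not at hnot
  obtain ⟨k, hk⟩ := hnot
  set N : Submodule (DiffOp n) ((Fin q → DiffOp n) ⧸ M) := I ^ k • ⊤ with hN
  have hne : N.mkQ (M.mkQ x) ≠ 0 := by
    rwa [Submodule.mkQ_apply N, Ne, Submodule.Quotient.mk_eq_zero]
  obtain ⟨φ, hφ⟩ := not_forall.1 (mt (Module.forall_dual_apply_eq_zero_iff ℂ _).1 hne)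
  refine ⟨k, φ ∘ₗ (N.mkQ ∘ₗ M.mkQ).restrictScalars ℂ, fun y hy => ?_, fun s hs y => ?_, hφ⟩
  · change φ (N.mkQ (M.mkQ y)) = 0
    rw [(Submodule.Quotient.mk_eq_zero M).2 hy |> (Submodule.mkQ_apply M y).trans, map_zero,
      map_zero]
  · change φ (N.mkQ (M.mkQ (s • y))) = 0
    have h : M.mkQ (s • y) ∈ N := by
      rw [map_smul]
      exact Submodule.smul_mem_smul hs trivial
    rw [Submodule.mkQ_apply N, (Submodule.Quotient.mk_eq_zero N).2 h, map_zero]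

theorem notMem_willemsClosure {n q : ℕ} {M : Submodule (DiffOp n) (Fin q → DiffOp n)}
    {x : Fin q → DiffOp n} (b : Fin n → ℚ)
    (hx : {r : DiffOp n | r • x ∈ M} ⊆
      (pointIdeal (fun j => (b j : ℂ)) : Set (DiffOp n))) :
    x ∉ willemsClosure (signalSpace n) M := by
  obtain ⟨k, ℓ, hM, hk, hℓx⟩ :=
    exists_functional (pointIdeal_isMaximal (fun j => (b j : ℂ))).ne_top hx
  have hk' : ∀ s ∈ pointIdeal (fun j => (b j : ℂ)) ^ (k + 1), ∀ y, ℓ (s • y) = 0 :=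
    fun s hs => hk s (Ideal.pow_le_pow_right k.le_succ hs)
  let L : (Fin q → DiffOp n) → (DiffOp n →ₗ[ℂ] ℂ) := fun y =>
    ℓ ∘ₗ (LinearMap.toSpanSingleton (DiffOp n) (Fin q → DiffOp n) y).restrictScalars ℂ
  have hL : ∀ y s, L y s = ℓ (s • y) := fun y s => rfl
  -- The `j`-th component comes from the functional `s ↦ ℓ (s e_j)`; by `D`-linearity, applying `r`
  -- to `f` yields the function attached to `s ↦ ℓ (s r)`.
  let f : Fin q → signalSpace n := fun j =>
    ⟨inverseSystem b (k + 1) (L (Pi.single j 1)), inverseSystem_mem_signalSpace _ _ _⟩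
  have hf : ∀ r : Fin q → DiffOp n,
      ∑ j, r j • (f j : smooth n) = inverseSystem b (k + 1) (L r) := by
    intro r
    calc ∑ j, r j • (f j : smooth n)
        = ∑ j, inverseSystem b (k + 1) (contract (r j) (L (Pi.single j 1))) :=
          Finset.sum_congr rfl fun j _ =>
            smul_inverseSystem b k (r j) _ fun s hs => hk' s hs _
      _ = inverseSystem b (k + 1) (L r) := by
          rw [← map_sum]
          congr 1
          refine LinearMap.ext fun s => ?_
          rw [LinearMap.sum_apply, hL]
          simp only [contract_apply, hL]
          rw [← map_sum]
          congr 1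
          funext i
          rw [Finset.sum_apply, Finset.sum_eq_single i]
          · simp [mul_comm]
          · intro j _ hj
            simp [hj.symm]
          · simp
  intro hmem
  have hfB : f ∈ behavior (signalSpace n) M := by
    rw [mem_behavior_submodule]
    intro r hr
    rw [hf, show L r = 0 from LinearMap.ext fun s => hM _ (M.smul_mem s hr), map_zero]
  -- Evaluating at the origin turns the equation `x(f) = 0` into `ℓ x = 0`.
  have h := congrArg (fun g : smooth n => (g : (Fin n → ℝ) → ℂ) 0)
    ((hf x).symm.trans ((mem_willemsClosure_submodule _ _ _).1 hmem f hfB))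
  simp only [inverseSystem_succ_apply_zero, hL, one_smul] at h
  exact hℓx h

/-! ### The support of a quotient -/

/-- A prime lies in the support when it contains the annihilator of some element, and the
annihilator of the class of `x` is `(M : x)`. -/
theorem mem_affineSupport_iff {n q : ℕ} {M N : Submodule (DiffOp n) (Fin q → DiffOp n)}
    {b : Fin n → ℂ} : b ∈ affineSupport (n := n) (N ⧸ M.submoduleOf N) ↔
      ∃ x ∈ N, {r : DiffOp n | r • x ∈ M} ⊆ (pointIdeal b : Set (DiffOp n)) := by
  have key : ∀ x : N, (Submodule.span (DiffOp n)
      {(Submodule.Quotient.mk x : N ⧸ M.submoduleOf N)}).annihilator ≤ pointIdeal b ↔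
      {r : DiffOp n | r • (x : Fin q → DiffOp n) ∈ M} ⊆ (pointIdeal b : Set (DiffOp n)) := by
    intro x
    refine forall_congr' fun r => ?_
    rw [Submodule.mem_annihilator_span_singleton, ← Submodule.Quotient.mk_smul,
      Submodule.Quotient.mk_eq_zero]
    rfl
  change point b ∈ Module.support (DiffOp n) (N ⧸ M.submoduleOf N) ↔ _
  rw [Module.mem_support_iff_exists_annihilator]
  constructor
  · rintro ⟨m, hm⟩
    obtain ⟨x, rfl⟩ := Submodule.Quotient.mk_surjective _ m
    exact ⟨x, x.2, (key x).1 hm⟩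
  · rintro ⟨x, hxN, hx⟩
    exact ⟨_, (key ⟨x, hxN⟩).2 hx⟩

theorem mem_willemsClosure_iff {n q : ℕ} {M : Submodule (DiffOp n) (Fin q → DiffOp n)}
    {x : Fin q → DiffOp n} : x ∈ willemsClosure (signalSpace n) M ↔
      ∀ b ∈ rationalPoints n, ¬ {r : DiffOp n | r • x ∈ M} ⊆ (pointIdeal b : Set (DiffOp n)) := by
  refine ⟨?_, mem_willemsClosure_of_forall⟩
  rintro hx _ ⟨b, rfl⟩ hb
  exact notMem_willemsClosure b hb hx

end PeriodicBehavior
end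

open PeriodicBehavior in
theorem proposition4p1 (n q : ℕ) (M : Submodule (DiffOp n) (Fin q → DiffOp n)) :
    (∀ x : Fin q → DiffOp n, x ∈ willemsClosure (signalSpace n) M ↔
      ∀ b ∈ rationalPoints n, ¬ {r : DiffOp n | r • x ∈ M} ⊆ (pointIdeal b : Set (DiffOp n))) ∧
    IsGreatest
      {N : Submodule (DiffOp n) (Fin q → DiffOp n) | M ≤ N ∧
        affineSupport (n := n) (N ⧸ M.submoduleOf N) ∩ rationalPoints n = ∅}
      (willemsClosure (signalSpace n) M) := by
  refine ⟨fun x => mem_willemsClosure_iff, ⟨fun r hr f hf => hf r hr, ?_⟩, ?_⟩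
  · refine Set.eq_empty_iff_forall_notMem.2 fun b hb => ?_
    obtain ⟨x, hx, hxb⟩ := mem_affineSupport_iff.1 hb.1
    exact mem_willemsClosure_iff.1 hx b hb.2 hxb
  · rintro N ⟨_, hN⟩ x hx
    refine mem_willemsClosure_iff.2 fun b hb hxb => ?_
    exact Set.eq_empty_iff_forall_notMem.1 hN b ⟨mem_affineSupport_iff.2 ⟨x, hx, hxb⟩, hb⟩
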